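/- Let $n\ge 1$, let $M_n=M_n(\mathbb C)$, and let $\rho$ be a quasi-order (a reflexive and transitive relation) on $\{1,\dots,n\}$. Let $\mathcal A_\rho=\{A\in M_n : A_{ij}\neq 0\Rightarrow (i,j)\in\rho\}$ be the corresponding structural matrix algebra, and let $E_{ij}$ denote the matrix units. A linear map $\phi:\mathcal A_\rho\to M_n$ is a Jordan homomorphism if $\phi(XY+YX)=\phi(X)\phi(Y)+\phi(Y)\phi(X)$ for all $X,Y\in\mathcal A_\rho$, a Jordan embedding if it is moreover injective, and a rank-one preserver if $\phi(X)$ has rank one for every $X\in\mathcal A_\rho$ of rank one. A map $g:\rho\to\mathbb C^\times$ is transitive if $g(i,j)g(j,k)=g(i,k)$ for all $(i,j),(j,k)\in\rho$; it induces the linear map $g^*:\mathcal A_\rho\to\mathcal A_\rho$, $g^*(E_{ij})=g(i,j)E_{ij}$ for $(i,j)\in\rho$. (a) Every linear unital rank-one preserver $\phi:\mathcal A_\rho\to M_n$ is a Jordan embedding. (b) Let $\phi:\mathcal A_\rho\to M_n$ be a Jordan homomorphism with $\phi(E_{ij})\neq 0$ for all $(i,j)\in\rho$. Then there exists a transitive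 map $g:\rho\to\mathbb C^\times$ associated with $\phi$, that is, such that for some invertible $S\in M_n$ and some central idempotent $P\in\mathcal A_\rho$ $$\phi(X)=S\bigl(P\,g^*(X)+(I-P)\,g^*(X)^t\bigr)S^{-1}\qquad\text{for all }X\in\mathcal A_\rho .$$ For every transitive map $g$ associated with $\phi$ in this sense, $\phi$ is a rank-one preserver if and only if $$\det\begin{bmatrix} g(i,j) & g(i,l)\\ g(k,j) & g(k,l)\end{bmatrix}=0$$ for all $1\le i,j,k,l\le n$ with $i\ne k$, $j\ne l$ and $(i,j),(i,l),(k,j),(k,l)\in\rho$. -/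

import Mathlib

/-- The structural matrix algebra `𝓐_ρ ⊆ M_n(ℂ)` of a quasi-order (reflexive transitive relation)
`ρ` on the index set: all matrices supported in `ρ`. -/
def structuralMatrixAlgebra {n : ℕ} (ρ : Fin n → Fin n → Prop) [IsPreorder (Fin n) ρ] :
    Subalgebra ℂ (Matrix (Fin n) (Fin n) ℂ) where
  carrier := {A | ∀ i j, A i j ≠ 0 → ρ i j}
  mul_mem' := by
    intro A B hA hB i j hij
    rw [Matrix.mul_apply] at hij
    obtain ⟨k, -, hk⟩ := Finset.exists_ne_zero_of_sum_ne_zero hij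
    exact _root_.trans (hA i k (left_ne_zero_of_mul hk)) (hB k j (right_ne_zero_of_mul hk))
  add_mem' := by
    intro A B hA hB i j hij
    by_cases h : A i j = 0
    · exact hB i j (fun h' => hij (by rw [Matrix.add_apply, h, h', add_zero]))
    · exact hA i j h
  algebraMap_mem' := by
    intro c i j hij
    by_cases h : i = j
    · exact h ▸ refl_of ρ i
    · exact absurd (by simp [Matrix.algebraMap_matrix_apply, h]) hij

namespace StructuralMatrixAlgebra

variable {n : ℕ} {ρ : Fin n → Fin n → Prop} [IsPreorder (Fin n) ρ]

/-- The matrix unit `E_ij`, for `(i, j) ∈ ρ`, as an element of `𝓐_ρ`. -/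
def matrixUnit (i j : Fin n) (h : ρ i j) : structuralMatrixAlgebra ρ :=
  ⟨Matrix.single i j 1, by
    intro a b hab
    by_cases h' : i = a ∧ j = b
    · obtain ⟨rfl, rfl⟩ := h'
      exact h
    · exact absurd (Matrix.single_apply_of_ne i j 1 a b h') hab⟩

/-- A linear map `φ : 𝓐_ρ → M_n` is a Jordan homomorphism if
`φ (X Y + Y X) = φ X φ Y + φ Y φ X` for all `X, Y`. -/
def IsJordanHom (φ : structuralMatrixAlgebra ρ →ₗ[ℂ] Matrix (Fin n) (Fin n) ℂ) : Prop :=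
  ∀ X Y : structuralMatrixAlgebra ρ, φ (X * Y + Y * X) = φ X * φ Y + φ Y * φ X

/-- A Jordan embedding is an injective Jordan homomorphism. -/
def IsJordanEmbedding (φ : structuralMatrixAlgebra ρ →ₗ[ℂ] Matrix (Fin n) (Fin n) ℂ) : Prop :=
  IsJordanHom φ ∧ Function.Injective φ

/-- `φ` maps matrices of rank one to matrices of rank one. -/
def PreservesRankOne (φ : structuralMatrixAlgebra ρ →ₗ[ℂ] Matrix (Fin n) (Fin n) ℂ) : Prop :=
  ∀ X : structuralMatrixAlgebra ρ,
    (X : Matrix (Fin n) (Fin n) ℂ).rank = 1 → (φ X).rank = 1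

/-- A map `g : ρ → ℂˣ` is transitive if `g(i,j) g(j,k) = g(i,k)` for all `(i,j), (j,k) ∈ ρ`. -/
def IsTransitiveMap (g : ∀ i j : Fin n, ρ i j → ℂˣ) : Prop :=
  ∀ (i j k : Fin n) (hij : ρ i j) (hjk : ρ j k),
    g i j hij * g j k hjk = g i k (_root_.trans hij hjk)

open Classical in
/-- The linear map `g* : 𝓐_ρ → 𝓐_ρ` with `g*(E_ij) = g(i,j) E_ij` for `(i, j) ∈ ρ`. -/
noncomputable def inducedMap (g : ∀ i j : Fin n, ρ i j → ℂˣ) :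
    structuralMatrixAlgebra ρ →ₗ[ℂ] structuralMatrixAlgebra ρ where
  toFun X := ⟨Matrix.of fun i j =>
      if h : ρ i j then (g i j h : ℂ) * (X : Matrix (Fin n) (Fin n) ℂ) i j else 0, by
    intro i j hij
    by_contra h
    exact hij (by simp [h])⟩
  map_add' X Y := by
    ext i j
    by_cases h : ρ i j <;> simp [h, mul_add]
  map_smul' c X := by
    ext i j
    by_cases h : ρ i j <;> simp [h, mul_left_comm]

theorem inducedMap_matrixUnit (g : ∀ i j : Fin n, ρ i j → ℂˣ) (i j : Fin n) (h : ρ i j) :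
    inducedMap g (matrixUnit i j h) = (g i j h : ℂ) • matrixUnit i j h := by
  ext a b
  by_cases h' : i = a ∧ j = b
  · obtain ⟨rfl, rfl⟩ := h'
    simp [inducedMap, matrixUnit, h]
  · have h0 : Matrix.single i j (1 : ℂ) a b = 0 := Matrix.single_apply_of_ne i j 1 a b h'
    simp [inducedMap, matrixUnit, h0]

/-- `g : ρ → ℂˣ` is a transitive map associated with `φ`: there are an invertible `S ∈ M_n` and a
central idempotent `P ∈ 𝓐_ρ` with `φ(X) = S (P g*(X) + (I - P) g*(X)ᵗ) S⁻¹` for all `X`. -/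
def IsAssociatedTransitiveMap (φ : structuralMatrixAlgebra ρ →ₗ[ℂ] Matrix (Fin n) (Fin n) ℂ)
    (g : ∀ i j : Fin n, ρ i j → ℂˣ) : Prop :=
  IsTransitiveMap g ∧
  ∃ (S : (Matrix (Fin n) (Fin n) ℂ)ˣ) (P : structuralMatrixAlgebra ρ),
    P ∈ Subalgebra.center ℂ (structuralMatrixAlgebra ρ) ∧ IsIdempotentElem P ∧
    ∀ X : structuralMatrixAlgebra ρ,
      φ X = (S : Matrix (Fin n) (Fin n) ℂ) *
        ((P : Matrix (Fin n) (Fin n) ℂ) * (inducedMap g X : Matrix (Fin n) (Fin n) ℂ) +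
          (1 - (P : Matrix (Fin n) (Fin n) ℂ)) *
            Matrix.transpose (inducedMap g X : Matrix (Fin n) (Fin n) ℂ)) *
        ((S⁻¹ : (Matrix (Fin n) (Fin n) ℂ)ˣ) : Matrix (Fin n) (Fin n) ℂ)

/-- All `2 × 2` minors of `g` on rectangles `(i,j), (i,l), (k,j), (k,l) ∈ ρ`, `i ≠ k`, `j ≠ l`,
vanish. -/
def RectangleMinorsVanish (g : ∀ i j : Fin n, ρ i j → ℂˣ) : Prop :=
  ∀ (i j k l : Fin n) (hij : ρ i j) (hil : ρ i l) (hkj : ρ k j) (hkl : ρ k l),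
    i ≠ k → j ≠ l →
      Matrix.det !![(g i j hij : ℂ), (g i l hil : ℂ); (g k j hkj : ℂ), (g k l hkl : ℂ)] = 0

end StructuralMatrixAlgebra

/-! Unital rank-one preservers and Jordan homomorphisms that kill no matrix unit are both forced
into one normal form. The images of the `E_ii` are `n` mutually orthogonal idempotents of rank one,
so a conjugation turns them back into the `E_ii`. Each off-diagonal `E_ij` must then go to `α_ij
E_ij + β_ij E_ji`.

The relations among the `α`, `β` leave exactly one of `α_ij`, `β_ij` nonzero, with the same choice
throughout each connected component of `ρ`. The components of type `α` are cut out by a central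
idempotent `P`, and `g = α + β` off the diagonal is transitive. This is
`exists_associated_of_normalForm`. The relations come from `2 × 2` minors of images of rank-one
matrices in (a), and from Jordan products of matrix units in (b).

Conversely the associated form is a homomorphism plus an antihomomorphism on complementary blocks,
hence a Jordan embedding, which gives (a). For the criterion in (b), the support of a rank-one `X`
lies in one component, so `φ X` is conjugate to `g* X` or its transpose, and only the minors of `g*
X` matter. -/

namespace Matrix

/-! ### Rank one and simultaneous diagonalisation. -/

variable {m o K : Type*} [Fintype o] [DecidableEq o] [Field K]

theorem rank_eq_one_iff_minors (M : Matrix m o K) :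
    M.rank = 1 ↔ M ≠ 0 ∧ ∀ i j k l, M i j * M k l = M i l * M k j := by
  constructor
  · intro h
    refine ⟨?_, ?_⟩
    · rintro rfl
      simp at h
    · obtain ⟨v, -, hv⟩ := finrank_eq_one_iff'.mp h
      have hcol : ∀ j, ∃ c : K, ∀ i, M i j = c * v.1 i := by
        intro j
        obtain ⟨c, hc⟩ := hv ⟨M.mulVecLin (Pi.single j 1), LinearMap.mem_range_self _ _⟩
        refine ⟨c, fun i => ?_⟩
        have := congrFun (congrArg Subtype.val hc) i
        simpa using this.symm
      choose c hc using hcol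
      intro i j k l
      rw [hc, hc, hc, hc]
      ring
  · rintro ⟨hne, hmin⟩
    obtain ⟨i₀, j₀, h₀⟩ : ∃ i j, M i j ≠ 0 := by
      by_contra! h
      exact hne (by ext i j; exact h i j)
    have hM : M = vecMulVec (fun i => M i j₀) (fun j => M i₀ j / M i₀ j₀) := by
      ext i j
      rw [vecMulVec_apply]
      field_simp
      exact hmin i j i₀ j₀
    have hle : M.rank ≤ 1 := by
      rw [hM]
      exact rank_vecMulVec_le _ _
    have hpos : M.rank ≠ 0 := fun h => hne <| by
      rw [← toLin'.map_eq_zero_iff, ← LinearMap.range_eq_bot]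
      exact Submodule.finrank_eq_zero.mp h
    omega

/-- Write `p i = u_i v_iᵗ` and collect the `u_i` as columns of `U`, the `v_i` as rows of `V`. The
sum condition says `U V = 1`; the matrices are square, so `V U = 1`, and `V (p i) U = (V U) E_ii (V
U)`. -/
theorem exists_units_conj_eq_single_of_rank_one {n : ℕ} (p : Fin n → Matrix (Fin n) (Fin n) K)
    (hp : ∀ i, (p i).rank = 1) (hsum : ∑ i, p i = 1) :
    ∃ S : (Matrix (Fin n) (Fin n) K)ˣ, ∀ i,
      (↑S⁻¹ : Matrix (Fin n) (Fin n) K) * p i * (S : Matrix (Fin n) (Fin n) K) = single i i 1 := by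
  have hfac : ∀ i, ∃ u v : Fin n → K, p i = vecMulVec u v := by
    intro i
    obtain ⟨hne, hmin⟩ := (rank_eq_one_iff_minors _).mp (hp i)
    obtain ⟨i₀, j₀, h₀⟩ : ∃ a b, p i a b ≠ 0 := by
      by_contra! h
      exact hne (by ext a b; exact h a b)
    refine ⟨fun a => p i a j₀, fun b => p i i₀ b / p i i₀ j₀, ?_⟩
    ext a b
    rw [vecMulVec_apply]
    field_simp
    exact hmin a b i₀ j₀
  choose u v huv using hfac
  have hUV : (of fun a i => u i a) * (of fun i b => v i b) = (1 : Matrix (Fin n) (Fin n) K) := by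
    rw [← hsum]
    ext a b
    simp [mul_apply, sum_apply, huv, vecMulVec_apply]
  have hVU := mul_eq_one_comm.mp hUV
  refine ⟨⟨of fun a i => u i a, of fun i b => v i b, hUV, hVU⟩, fun i => ?_⟩
  have hpi : p i = (of fun a i => u i a) * single i i 1 * (of fun i b => v i b) := by
    ext a b
    rw [huv, vecMulVec_apply, mul_apply, Finset.sum_eq_single i]
    · simp
    · intro c _ hc
      simp [hc]
    · simp
  change (of fun i b => v i b) * p i * (of fun a i => u i a) = _
  rw [hpi]
  calc _ = ((of fun i b => v i b) * (of fun a i => u i a)) * single i i 1 *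
        ((of fun i b => v i b) * (of fun a i => u i a)) := by simp only [Matrix.mul_assoc]
    _ = _ := by rw [hVU, Matrix.one_mul, Matrix.mul_one]

/-- A nonzero vector fixed by `p i` is killed by every other `p j`. Such vectors are independent,
and there are `n` of them, so they form a basis diagonalising all `p i` at once. -/
theorem exists_units_conj_eq_single_of_orthogonal {n : ℕ} (p : Fin n → Matrix (Fin n) (Fin n) K)
    (hne : ∀ i, p i ≠ 0) (hidem : ∀ i, p i * p i = p i) (horth : ∀ i j, i ≠ j → p i * p j = 0) :
    ∃ S : (Matrix (Fin n) (Fin n) K)ˣ, ∀ i,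
      (↑S⁻¹ : Matrix (Fin n) (Fin n) K) * p i * (S : Matrix (Fin n) (Fin n) K) = single i i 1 := by
  have hvec : ∀ i, ∃ v : Fin n → K, v ≠ 0 ∧ p i *ᵥ v = v := by
    intro i
    obtain ⟨w, hw⟩ : ∃ w, p i *ᵥ w ≠ 0 := by
      by_contra! h
      refine hne i (Matrix.ext_of_mulVec_single fun j => ?_)
      rw [h, zero_mulVec]
    exact ⟨_, hw, by rw [mulVec_mulVec, hidem]⟩
  choose v hv hpv using hvec
  have hpv' : ∀ i j, i ≠ j → p i *ᵥ v j = 0 := by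
    intro i j hij
    rw [← hpv j, mulVec_mulVec, horth i j hij, zero_mulVec]
  have hli : LinearIndependent K v := by
    rw [Fintype.linearIndependent_iff]
    intro c hc i
    have h := congrArg (p i *ᵥ ·) hc
    simp only [mulVec_sum, mulVec_smul, mulVec_zero] at h
    rw [Finset.sum_eq_single i (fun j _ hj => by rw [hpv' i j hj.symm, smul_zero]) (by simp),
      hpv i] at h
    exact (smul_eq_zero.mp h).resolve_right (hv i)
  have hU : IsUnit (of fun a i => v i a : Matrix (Fin n) (Fin n) K) :=
    linearIndependent_cols_iff_isUnit.mp hli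
  obtain ⟨S, hS⟩ := hU
  refine ⟨S, fun i => ?_⟩
  have hpS : p i * (S : Matrix (Fin n) (Fin n) K) = (S : Matrix (Fin n) (Fin n) K) * single i i 1 := by
    rw [hS]
    ext a b
    have h1 : (p i * of fun a i => v i a) a b = (p i *ᵥ v b) a := rfl
    rw [h1]
    by_cases hib : i = b
    · subst hib
      rw [hpv]
      simp
    · rw [hpv' i b hib]
      simp [Ne.symm hib]
  rw [Matrix.mul_assoc, hpS, ← Matrix.mul_assoc, Units.inv_mul, Matrix.one_mul]

end Matrix

namespace StructuralMatrixAlgebra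

open Matrix

variable {n : ℕ} {ρ : Fin n → Fin n → Prop} [IsPreorder (Fin n) ρ]

/-! ### Matrix units and the induced map. -/

theorem coe_matrixUnit (i j : Fin n) (h : ρ i j) :
    (matrixUnit i j h : Matrix (Fin n) (Fin n) ℂ) = single i j 1 := rfl

theorem rel_of_ne_zero (X : structuralMatrixAlgebra ρ) {i j : Fin n}
    (h : (X : Matrix (Fin n) (Fin n) ℂ) i j ≠ 0) : ρ i j := X.2 i j h

open Classical in
theorem eq_sum_matrixUnit (X : structuralMatrixAlgebra ρ) :
    X = ∑ i, ∑ j, if h : ρ i j then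
      (X : Matrix (Fin n) (Fin n) ℂ) i j • matrixUnit i j h else 0 := by
  apply Subtype.ext
  push_cast
  conv_lhs => rw [matrix_eq_sum_single (X : Matrix (Fin n) (Fin n) ℂ)]
  refine Finset.sum_congr rfl fun i _ => Finset.sum_congr rfl fun j _ => ?_
  by_cases h : ρ i j
  · simp [h, coe_matrixUnit]
  · have : (X : Matrix (Fin n) (Fin n) ℂ) i j = 0 := by
      by_contra h'
      exact h (rel_of_ne_zero X h')
    simp [h, this]

theorem linearMap_ext_matrixUnit {V : Type*} [AddCommGroup V] [Module ℂ V]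
    {f g : structuralMatrixAlgebra ρ →ₗ[ℂ] V}
    (h : ∀ i j (hij : ρ i j), f (matrixUnit i j hij) = g (matrixUnit i j hij)) : f = g := by
  classical
  ext X
  rw [eq_sum_matrixUnit X]
  simp only [map_sum]
  refine Finset.sum_congr rfl fun i _ => Finset.sum_congr rfl fun j _ => ?_
  by_cases hij : ρ i j
  · simp [hij, h]
  · simp [hij]

theorem inducedMap_apply (g : ∀ i j : Fin n, ρ i j → ℂˣ) (X : structuralMatrixAlgebra ρ)
    (i j : Fin n) (h : ρ i j) :
    (inducedMap g X : Matrix (Fin n) (Fin n) ℂ) i j =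
      g i j h * (X : Matrix (Fin n) (Fin n) ℂ) i j := by
  simp [inducedMap, h]

theorem inducedMap_apply_eq_zero_iff (g : ∀ i j : Fin n, ρ i j → ℂˣ)
    (X : structuralMatrixAlgebra ρ) (i j : Fin n) :
    (inducedMap g X : Matrix (Fin n) (Fin n) ℂ) i j = 0 ↔
      (X : Matrix (Fin n) (Fin n) ℂ) i j = 0 := by
  by_cases h : ρ i j
  · simp [inducedMap_apply g X i j h]
  · have h1 : (X : Matrix (Fin n) (Fin n) ℂ) i j = 0 := by
      by_contra h'
      exact h (rel_of_ne_zero X h')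
    have h2 : (inducedMap g X : Matrix (Fin n) (Fin n) ℂ) i j = 0 := by
      by_contra h'
      exact h (rel_of_ne_zero _ h')
    simp [h1, h2]

theorem inducedMap_mul {g : ∀ i j : Fin n, ρ i j → ℂˣ} (hg : IsTransitiveMap g)
    (X Y : structuralMatrixAlgebra ρ) :
    inducedMap g (X * Y) = inducedMap g X * inducedMap g Y := by
  apply Subtype.ext
  ext i j
  by_cases hij : ρ i j
  · rw [inducedMap_apply g _ i j hij]
    simp only [Subalgebra.coe_mul, mul_apply, Finset.mul_sum]
    refine Finset.sum_congr rfl fun k _ => ?_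
    by_cases hX : (X : Matrix (Fin n) (Fin n) ℂ) i k = 0
    · rw [hX, (inducedMap_apply_eq_zero_iff g X i k).mpr hX]
      simp
    by_cases hY : (Y : Matrix (Fin n) (Fin n) ℂ) k j = 0
    · rw [hY, (inducedMap_apply_eq_zero_iff g Y k j).mpr hY]
      simp
    have hik := rel_of_ne_zero X hX
    have hkj := rel_of_ne_zero Y hY
    rw [inducedMap_apply g X i k hik, inducedMap_apply g Y k j hkj, ← hg i k j hik hkj]
    push_cast
    ring
  · have key : ∀ Z : structuralMatrixAlgebra ρ, (Z : Matrix (Fin n) (Fin n) ℂ) i j = 0 :=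
      fun Z => by
        by_contra h'
        exact hij (rel_of_ne_zero Z h')
    rw [key, key]

theorem inducedMap_injective (g : ∀ i j : Fin n, ρ i j → ℂˣ) :
    Function.Injective (inducedMap g) := by
  rw [injective_iff_map_eq_zero]
  intro X hX
  apply Subtype.ext
  ext i j
  have := (inducedMap_apply_eq_zero_iff g X i j).mp (by rw [hX]; rfl)
  simpa using this

/-! ### Central idempotents and the Jordan property of associated maps. -/

theorem coe_mul_comm_of_mem_center {P : structuralMatrixAlgebra ρ}
    (hP : P ∈ Subalgebra.center ℂ (structuralMatrixAlgebra ρ)) (X : structuralMatrixAlgebra ρ) :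
    (X : Matrix (Fin n) (Fin n) ℂ) * P = P * X :=
  congrArg Subtype.val (Subalgebra.mem_center_iff.mp hP X)

theorem apply_eq_zero_of_mem_center {P : structuralMatrixAlgebra ρ}
    (hP : P ∈ Subalgebra.center ℂ (structuralMatrixAlgebra ρ)) {i j : Fin n} (hij : i ≠ j) :
    (P : Matrix (Fin n) (Fin n) ℂ) i j = 0 := by
  have h := congrFun (congrFun
    (coe_mul_comm_of_mem_center hP (matrixUnit i i (refl_of ρ i))) i) j
  rw [coe_matrixUnit] at h
  simpa [hij.symm] using h

theorem eq_diagonal_of_mem_center {P : structuralMatrixAlgebra ρ}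
    (hP : P ∈ Subalgebra.center ℂ (structuralMatrixAlgebra ρ)) :
    (P : Matrix (Fin n) (Fin n) ℂ) = diagonal fun i => (P : Matrix (Fin n) (Fin n) ℂ) i i := by
  ext i j
  by_cases h : i = j
  · subst h
    simp
  · simp [h, apply_eq_zero_of_mem_center hP h]

theorem transpose_of_mem_center {P : structuralMatrixAlgebra ρ}
    (hP : P ∈ Subalgebra.center ℂ (structuralMatrixAlgebra ρ)) :
    (P : Matrix (Fin n) (Fin n) ℂ)ᵀ = P := by
  rw [eq_diagonal_of_mem_center hP, diagonal_transpose]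

theorem apply_eq_zero_or_one {P : structuralMatrixAlgebra ρ}
    (hP : P ∈ Subalgebra.center ℂ (structuralMatrixAlgebra ρ)) (hidem : IsIdempotentElem P)
    (i : Fin n) :
    (P : Matrix (Fin n) (Fin n) ℂ) i i = 0 ∨ (P : Matrix (Fin n) (Fin n) ℂ) i i = 1 := by
  have h := congrFun (congrFun (congrArg Subtype.val hidem.eq) i) i
  rw [Subalgebra.coe_mul, eq_diagonal_of_mem_center hP] at h
  simp only [diagonal_mul_diagonal, diagonal_apply_eq] at h
  exact (IsIdempotentElem.iff_eq_zero_or_one).mp h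

/-- Commuting with `E_ij` is what forces this. A central idempotent is therefore the indicator of a
union of connected components of `ρ`. -/
theorem apply_eq_of_rel {P : structuralMatrixAlgebra ρ}
    (hP : P ∈ Subalgebra.center ℂ (structuralMatrixAlgebra ρ)) {i j : Fin n} (h : ρ i j) :
    (P : Matrix (Fin n) (Fin n) ℂ) i i = (P : Matrix (Fin n) (Fin n) ℂ) j j := by
  have h := congrFun (congrFun (coe_mul_comm_of_mem_center hP (matrixUnit i j h)) i) j
  rw [coe_matrixUnit] at h
  simpa using h.symm

theorem isJordanEmbedding_of_associated
    {φ : structuralMatrixAlgebra ρ →ₗ[ℂ] Matrix (Fin n) (Fin n) ℂ}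
    {g : ∀ i j : Fin n, ρ i j → ℂˣ} (h : IsAssociatedTransitiveMap φ g) :
    IsJordanEmbedding φ := by
  obtain ⟨hg, S, P, hP, hidem, hφ⟩ := h
  have hPP : (P : Matrix (Fin n) (Fin n) ℂ) * P = P := congrArg Subtype.val hidem.eq
  have hc := fun X => coe_mul_comm_of_mem_center hP X
  have hct : ∀ X : structuralMatrixAlgebra ρ,
      (X : Matrix (Fin n) (Fin n) ℂ)ᵀ * P = P * (X : Matrix (Fin n) (Fin n) ℂ)ᵀ := by
    intro X
    have := congrArg transpose (hc X)
    rw [transpose_mul, transpose_mul, transpose_of_mem_center hP] at this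
    exact this.symm
  -- Centrality kills the cross terms between the blocks `P` and `1 - P`. The second block
  -- multiplies in reverse order, which symmetrising in `X`, `Y` hides.
  have hprod : ∀ X Y : structuralMatrixAlgebra ρ, φ X * φ Y = (S : Matrix (Fin n) (Fin n) ℂ) *
      ((P : Matrix (Fin n) (Fin n) ℂ) * ((inducedMap g X : Matrix (Fin n) (Fin n) ℂ) *
          (inducedMap g Y : Matrix (Fin n) (Fin n) ℂ)) +
        (1 - (P : Matrix (Fin n) (Fin n) ℂ)) *
          ((inducedMap g X : Matrix (Fin n) (Fin n) ℂ)ᵀ *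
            (inducedMap g Y : Matrix (Fin n) (Fin n) ℂ)ᵀ)) *
      (↑S⁻¹ : Matrix (Fin n) (Fin n) ℂ) := by
    intro X Y
    have h1 := hc (inducedMap g X)
    have h2 := hct (inducedMap g X)
    rw [hφ, hφ]
    generalize (inducedMap g X : Matrix (Fin n) (Fin n) ℂ) = A at *
    generalize (inducedMap g Y : Matrix (Fin n) (Fin n) ℂ) = B at *
    generalize (P : Matrix (Fin n) (Fin n) ℂ) = Q at *
    have hS : (↑S⁻¹ : Matrix (Fin n) (Fin n) ℂ) * S = 1 := Units.inv_mul S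
    have h3 : Q * A * (Q * B) = Q * (A * B) := by
      rw [Matrix.mul_assoc, ← Matrix.mul_assoc A, h1, Matrix.mul_assoc, ← Matrix.mul_assoc, hPP]
    have h4 : Q * A * ((1 - Q) * Bᵀ) = 0 := by
      rw [Matrix.mul_assoc, ← Matrix.mul_assoc A, Matrix.mul_sub, h1, Matrix.mul_one,
        ← Matrix.mul_assoc, Matrix.mul_sub, ← Matrix.mul_assoc, hPP, sub_self, Matrix.zero_mul]
    have h1' : Aᵀ * (1 - Q) = (1 - Q) * Aᵀ := by
      rw [Matrix.mul_sub, Matrix.sub_mul, h2, Matrix.mul_one, Matrix.one_mul]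
    have h5 : (1 - Q) * Aᵀ * (Q * B) = 0 := by
      rw [Matrix.mul_assoc, ← Matrix.mul_assoc Aᵀ, h2, ← Matrix.mul_assoc, ← Matrix.mul_assoc,
        Matrix.sub_mul, hPP, Matrix.one_mul, sub_self, Matrix.zero_mul, Matrix.zero_mul]
    have h6 : (1 - Q) * Aᵀ * ((1 - Q) * Bᵀ) = (1 - Q) * (Aᵀ * Bᵀ) := by
      have hQ : (1 - Q) * (1 - Q) = 1 - Q := by
        rw [Matrix.mul_sub, Matrix.sub_mul 1 Q Q, hPP]
        simp
      rw [Matrix.mul_assoc, ← Matrix.mul_assoc Aᵀ, h1', Matrix.mul_assoc, ← Matrix.mul_assoc, hQ]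
    calc _ = (S : Matrix (Fin n) (Fin n) ℂ) * ((Q * A + (1 - Q) * Aᵀ) *
          (↑S⁻¹ * (S : Matrix (Fin n) (Fin n) ℂ)) * (Q * B + (1 - Q) * Bᵀ)) *
          (↑S⁻¹ : Matrix (Fin n) (Fin n) ℂ) := by simp only [Matrix.mul_assoc]
      _ = _ := by
        rw [hS, Matrix.mul_one, Matrix.add_mul, Matrix.mul_add (Q * A), Matrix.mul_add ((1 - Q) * Aᵀ), h3, h4, h5, h6]
        simp
  refine ⟨fun X Y => ?_, ?_⟩
  · rw [hprod, hprod, hφ, map_add, inducedMap_mul hg, inducedMap_mul hg]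
    simp only [Subalgebra.coe_add, Subalgebra.coe_mul, transpose_add, transpose_mul,
      Matrix.mul_add, Matrix.add_mul]
    abel
  · rw [injective_iff_map_eq_zero]
    intro X hX
    have h0 : (P : Matrix (Fin n) (Fin n) ℂ) * (inducedMap g X : Matrix (Fin n) (Fin n) ℂ) +
        (1 - (P : Matrix (Fin n) (Fin n) ℂ)) *
          (inducedMap g X : Matrix (Fin n) (Fin n) ℂ)ᵀ = 0 := by
      rw [hφ, Units.mul_left_eq_zero, Units.mul_right_eq_zero] at hX
      exact hX
    refine (injective_iff_map_eq_zero _).mp (inducedMap_injective g) X ?_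
    apply Subtype.ext
    have h1 := hc (inducedMap g X)
    generalize (inducedMap g X : Matrix (Fin n) (Fin n) ℂ) = A at *
    have ht := transpose_of_mem_center hP
    generalize (P : Matrix (Fin n) (Fin n) ℂ) = Q at *
    -- Multiplying by `Q` isolates the first block; transposing what remains isolates the second.
    have hA : Q * A = 0 := by
      have := congrArg (Q * ·) h0
      simpa [Matrix.mul_add, ← Matrix.mul_assoc, hPP, Matrix.mul_sub] using this
    rw [hA, zero_add] at h0
    have h2 : A * (1 - Q) = 0 := by
      have := congrArg transpose h0
      simpa [transpose_mul, ht] using this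
    rw [Matrix.mul_sub, h1, hA, Matrix.mul_one, sub_zero] at h2
    exact h2

/-! ### Minor identities and the rank-one criterion. -/

theorem PreservesRankOne.minors {φ : structuralMatrixAlgebra ρ →ₗ[ℂ] Matrix (Fin n) (Fin n) ℂ}
    (hφ : PreservesRankOne φ) (X : structuralMatrixAlgebra ρ) (u v : Fin n → ℂ)
    (hX : (X : Matrix (Fin n) (Fin n) ℂ) = vecMulVec u v) (a b c d : Fin n) :
    φ X a b * φ X c d = φ X a d * φ X c b := by
  -- Admitting `X = 0` spares any nonvanishing condition on `u`, `v` in later uses.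
  by_cases h0 : X = 0
  · simp [h0]
  · refine ((rank_eq_one_iff_minors _).mp (hφ X ((rank_eq_one_iff_minors _).mpr
      ⟨fun h => h0 (Subtype.ext h), fun i j k l => ?_⟩))).2 a b c d
    simp only [hX, vecMulVec_apply]
    ring

/-- The indices may coincide and the parameters may vanish, so the same formula also covers rank-one
matrices supported on a single row or column. -/
theorem coe_rectangle {i k j l : Fin n} (hij : ρ i j) (hil : ρ i l) (hkj : ρ k j) (hkl : ρ k l)
    (s t x y : ℂ) :
    (((s * x) • matrixUnit i j hij + (s * y) • matrixUnit i l hil + (t * x) • matrixUnit k j hkj +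
      (t * y) • matrixUnit k l hkl : structuralMatrixAlgebra ρ) : Matrix (Fin n) (Fin n) ℂ) =
    vecMulVec (Pi.single i s + Pi.single k t) (Pi.single j x + Pi.single l y) := by
  have hs : ∀ (a b : Fin n) (c d : ℂ),
      vecMulVec (Pi.single a c) (Pi.single b d) = single a b (c * d) := by
    intro a b c d
    ext a' b'
    by_cases ha : a' = a
    · by_cases hb : b' = b
      · subst ha hb
        simp [vecMulVec_apply]
      · simp [vecMulVec_apply, hb, Ne.symm hb]
    · simp [vecMulVec_apply, ha, Ne.symm ha]
  simp only [Subalgebra.coe_add, Subalgebra.coe_smul, coe_matrixUnit, vecMulVec_add,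
    add_vecMulVec, hs, smul_single, smul_eq_mul, mul_one]
  abel

theorem PreservesRankOne.rectangle_minors
    {φ : structuralMatrixAlgebra ρ →ₗ[ℂ] Matrix (Fin n) (Fin n) ℂ} (hφ : PreservesRankOne φ)
    {i k j l : Fin n} (hij : ρ i j) (hil : ρ i l) (hkj : ρ k j) (hkl : ρ k l) (s t x y : ℂ)
    (M : Matrix (Fin n) (Fin n) ℂ)
    (hM : M = (s * x) • φ (matrixUnit i j hij) + (s * y) • φ (matrixUnit i l hil) +
      (t * x) • φ (matrixUnit k j hkj) + (t * y) • φ (matrixUnit k l hkl)) (a b c d : Fin n) :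
    M a b * M c d = M a d * M c b := by
  have h := hφ.minors _ _ _ (coe_rectangle hij hil hkj hkl s t x y) a b c d
  simp only [map_add, map_smul] at h
  rw [hM]
  exact h

theorem rank_units_conj (S : (Matrix (Fin n) (Fin n) ℂ)ˣ) (M : Matrix (Fin n) (Fin n) ℂ) :
    ((S : Matrix (Fin n) (Fin n) ℂ) * M * (↑S⁻¹ : Matrix (Fin n) (Fin n) ℂ)).rank = M.rank := by
  rw [rank_mul_eq_left_of_isUnit_det _ _ ((isUnit_iff_isUnit_det _).mp S⁻¹.isUnit),
    rank_mul_eq_right_of_isUnit_det _ _ ((isUnit_iff_isUnit_det _).mp S.isUnit)]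

theorem preservesRankOne_iff {φ : structuralMatrixAlgebra ρ →ₗ[ℂ] Matrix (Fin n) (Fin n) ℂ}
    {g : ∀ i j : Fin n, ρ i j → ℂˣ} (h : IsAssociatedTransitiveMap φ g) :
    PreservesRankOne φ ↔ RectangleMinorsVanish g := by
  have hinj := (isJordanEmbedding_of_associated h).2
  obtain ⟨-, S, P, hP, hidem, hφ⟩ := h
  have hentry : ∀ (X : structuralMatrixAlgebra ρ) a b,
      ((P : Matrix (Fin n) (Fin n) ℂ) * (inducedMap g X : Matrix (Fin n) (Fin n) ℂ) +
        (1 - (P : Matrix (Fin n) (Fin n) ℂ)) *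
          (inducedMap g X : Matrix (Fin n) (Fin n) ℂ)ᵀ) a b =
      (P : Matrix (Fin n) (Fin n) ℂ) a a * (inducedMap g X : Matrix (Fin n) (Fin n) ℂ) a b +
      (1 - (P : Matrix (Fin n) (Fin n) ℂ) a a) *
        (inducedMap g X : Matrix (Fin n) (Fin n) ℂ) b a := by
    intro X a b
    rw [eq_diagonal_of_mem_center hP, Matrix.sub_mul, Matrix.one_mul, Matrix.add_apply,
      Matrix.sub_apply, diagonal_mul, diagonal_mul, transpose_apply, diagonal_apply_eq]
    ring
  constructor
  · intro hpres i j k l hij hil hkj hkl hik hjl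
    have hX := coe_rectangle hij hil hkj hkl 1 1 1 1
    set X := ((1 : ℂ) * 1) • matrixUnit i j hij + ((1 : ℂ) * 1) • matrixUnit i l hil +
      ((1 : ℂ) * 1) • matrixUnit k j hkj + ((1 : ℂ) * 1) • matrixUnit k l hkl
    have hrank : (X : Matrix (Fin n) (Fin n) ℂ).rank = 1 := by
      refine (rank_eq_one_iff_minors _).mpr ⟨fun h0 => ?_, fun a b c d => ?_⟩
      · have := congrFun (congrFun (hX.symm.trans h0) i) j
        simp [vecMulVec_apply, hik, hjl] at this
      · simp only [hX, vecMulVec_apply]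
        ring
    have hmin := hpres X hrank
    rw [hφ, rank_units_conj, rank_eq_one_iff_minors] at hmin
    have hg : ∀ a b (hab : ρ a b), (X : Matrix (Fin n) (Fin n) ℂ) a b = 1 →
        (inducedMap g X : Matrix (Fin n) (Fin n) ℂ) a b = g a b hab := by
      intro a b hab h1
      rw [inducedMap_apply g X a b hab, h1, mul_one]
    have h1 := hg i j hij (by simp [hX, vecMulVec_apply, hik, hjl])
    have h2 := hg i l hil (by simp [hX, vecMulVec_apply, hik, hjl.symm])
    have h3 := hg k j hkj (by simp [hX, vecMulVec_apply, hik.symm, hjl])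
    have h4 := hg k l hkl (by simp [hX, vecMulVec_apply, hik.symm, hjl.symm])
    have p1 := apply_eq_of_rel hP hij
    have p2 := apply_eq_of_rel hP hkj
    have p3 := apply_eq_of_rel hP hkl
    rw [det_fin_two_of, sub_eq_zero, ← h1, ← h2, ← h3, ← h4]
    -- On a block where `P` vanishes the image is transposed, so the minor is read at the transposed
    -- positions.
    rcases apply_eq_zero_or_one hP hidem i with hp | hp
    · have := hmin.2 j i l k
      simp only [hentry, ← p3, p2, ← p1, hp] at this
      linear_combination this
    · have := hmin.2 i j k l
      simp only [hentry, p2, ← p1, hp] at this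
      linear_combination this
  · intro hrect X hX
    obtain ⟨hne, hmin⟩ := (rank_eq_one_iff_minors _).mp hX
    obtain ⟨i₀, j₀, h₀⟩ : ∃ a b, (X : Matrix (Fin n) (Fin n) ℂ) a b ≠ 0 := by
      by_contra! h
      exact hne (by ext a b; exact h a b)
    have hφne : φ X ≠ 0 := fun h0 => hne <| by
      rw [(injective_iff_map_eq_zero φ).mp hinj X h0]
      rfl
    -- `X a b * X i₀ j₀ = X a j₀ * X i₀ b` makes `X a j₀` nonzero, so `a` and `i₀` are both related
    -- to `j₀`: the support lies in one component.
    have hpe : ∀ a b, (X : Matrix (Fin n) (Fin n) ℂ) a b ≠ 0 →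
        (P : Matrix (Fin n) (Fin n) ℂ) a a = (P : Matrix (Fin n) (Fin n) ℂ) i₀ i₀ := by
      intro a b hab
      have h1 : (X : Matrix (Fin n) (Fin n) ℂ) a j₀ ≠ 0 := by
        have := hmin a b i₀ j₀
        exact left_ne_zero_of_mul (this ▸ mul_ne_zero hab h₀)
      rw [apply_eq_of_rel hP (rel_of_ne_zero X h1), apply_eq_of_rel hP (rel_of_ne_zero X h₀)]
    have hpe' : ∀ a b, (X : Matrix (Fin n) (Fin n) ℂ) b a ≠ 0 →
        (P : Matrix (Fin n) (Fin n) ℂ) a a = (P : Matrix (Fin n) (Fin n) ℂ) i₀ i₀ := by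
      intro a b hab
      rw [← apply_eq_of_rel hP (rel_of_ne_zero X hab), hpe b a hab]
    have hA : ∀ a b c d, (inducedMap g X : Matrix (Fin n) (Fin n) ℂ) a b *
        (inducedMap g X : Matrix (Fin n) (Fin n) ℂ) c d =
        (inducedMap g X : Matrix (Fin n) (Fin n) ℂ) a d *
        (inducedMap g X : Matrix (Fin n) (Fin n) ℂ) c b := by
      intro a b c d
      -- Since `g*` preserves supports, a zero product makes both sides vanish; otherwise all four
      -- corners lie in `ρ` and the determinant condition applies.
      by_cases hz : (X : Matrix (Fin n) (Fin n) ℂ) a b * (X : Matrix (Fin n) (Fin n) ℂ) c d = 0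
      · have hz' := hz
        rw [hmin] at hz'
        have e1 : (inducedMap g X : Matrix (Fin n) (Fin n) ℂ) a b *
            (inducedMap g X : Matrix (Fin n) (Fin n) ℂ) c d = 0 := by
          simpa [inducedMap_apply_eq_zero_iff] using hz
        have e2 : (inducedMap g X : Matrix (Fin n) (Fin n) ℂ) a d *
            (inducedMap g X : Matrix (Fin n) (Fin n) ℂ) c b = 0 := by
          simpa [inducedMap_apply_eq_zero_iff] using hz'
        rw [e1, e2]
      · have hz' := hz
        rw [hmin] at hz'
        have hab := rel_of_ne_zero X (left_ne_zero_of_mul hz)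
        have hcd := rel_of_ne_zero X (right_ne_zero_of_mul hz)
        have had := rel_of_ne_zero X (left_ne_zero_of_mul hz')
        have hcb := rel_of_ne_zero X (right_ne_zero_of_mul hz')
        by_cases hac : a = c
        · subst hac
          ring
        by_cases hbd : b = d
        · subst hbd
          ring
        have hdet := hrect a b c d hab had hcb hcd hac hbd
        rw [det_fin_two_of, sub_eq_zero] at hdet
        rw [inducedMap_apply g X a b hab, inducedMap_apply g X c d hcd,
          inducedMap_apply g X a d had, inducedMap_apply g X c b hcb]
        linear_combination (X : Matrix (Fin n) (Fin n) ℂ) a b *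
          (X : Matrix (Fin n) (Fin n) ℂ) c d * hdet +
          (g a d had * g c b hcb : ℂ) * hmin a b c d
    have hcollapse : ∀ a b,
        ((P : Matrix (Fin n) (Fin n) ℂ) * (inducedMap g X : Matrix (Fin n) (Fin n) ℂ) +
          (1 - (P : Matrix (Fin n) (Fin n) ℂ)) *
            (inducedMap g X : Matrix (Fin n) (Fin n) ℂ)ᵀ) a b =
        (P : Matrix (Fin n) (Fin n) ℂ) i₀ i₀ * (inducedMap g X : Matrix (Fin n) (Fin n) ℂ) a b +
        (1 - (P : Matrix (Fin n) (Fin n) ℂ) i₀ i₀) *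
          (inducedMap g X : Matrix (Fin n) (Fin n) ℂ) b a := by
      intro a b
      rw [hentry]
      by_cases h1 : (X : Matrix (Fin n) (Fin n) ℂ) a b = 0
      · by_cases h2 : (X : Matrix (Fin n) (Fin n) ℂ) b a = 0
        · rw [(inducedMap_apply_eq_zero_iff g X a b).mpr h1,
            (inducedMap_apply_eq_zero_iff g X b a).mpr h2]
          simp
        · rw [hpe' a b h2]
      · rw [hpe a b h1]
    have hrk := rank_units_conj S
      ((P : Matrix (Fin n) (Fin n) ℂ) * (inducedMap g X : Matrix (Fin n) (Fin n) ℂ) +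
          (1 - (P : Matrix (Fin n) (Fin n) ℂ)) *
            (inducedMap g X : Matrix (Fin n) (Fin n) ℂ)ᵀ)
    rw [hφ] at hφne ⊢
    rw [hrk, rank_eq_one_iff_minors]
    refine ⟨fun h0 => hφne (by rw [h0]; simp), fun a b c d => ?_⟩
    rw [hcollapse, hcollapse, hcollapse, hcollapse]
    rcases apply_eq_zero_or_one hP hidem i₀ with hp | hp
    · rw [hp]
      linear_combination hA b a d c
    · rw [hp]
      linear_combination hA a b c d

/-! ### From coefficient relations to `g` and `P`. -/

-- The relations are stated for bare coefficients so that rank-one preservers and Jordan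
-- homomorphisms can share the argument. They prevent `α`-edges and `β`-edges from meeting at a
-- vertex, so the type of an edge is constant on components.
open Classical in
theorem exists_associated_of_normalForm
    {φ : structuralMatrixAlgebra ρ →ₗ[ℂ] Matrix (Fin n) (Fin n) ℂ}
    (S : (Matrix (Fin n) (Fin n) ℂ)ˣ) (α β : ∀ i j, ρ i j → ℂ)
    (hdiag : ∀ i, φ (matrixUnit i i (refl_of ρ i)) =
      (S : Matrix (Fin n) (Fin n) ℂ) * single i i 1 * (↑S⁻¹ : Matrix (Fin n) (Fin n) ℂ))
    (hoff : ∀ i j (h : ρ i j), i ≠ j → φ (matrixUnit i j h) =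
      (S : Matrix (Fin n) (Fin n) ℂ) * (single i j (α i j h) + single j i (β i j h)) *
        (↑S⁻¹ : Matrix (Fin n) (Fin n) ℂ))
    (hne : ∀ i j (h : ρ i j), i ≠ j → α i j h ≠ 0 ∨ β i j h ≠ 0)
    (hout : ∀ i j k (h : ρ i j) (h' : ρ i k), i ≠ j → i ≠ k → α i j h * β i k h' = 0)
    (hin : ∀ i j k (h : ρ i j) (h' : ρ k j), i ≠ j → k ≠ j → α i j h * β k j h' = 0)
    (htrans : ∀ i j k (h : ρ i j) (h' : ρ j k), i ≠ j → j ≠ k → i ≠ k →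
      α i j h * α j k h' = α i k (_root_.trans h h') ∧
        β i j h * β j k h' = β i k (_root_.trans h h'))
    (hinv : ∀ i j (h : ρ i j) (h' : ρ j i), i ≠ j →
      α i j h * α j i h' + β i j h * β j i h' = 1) :
    ∃ g : ∀ i j : Fin n, ρ i j → ℂˣ, IsAssociatedTransitiveMap φ g := by
  have hpath : ∀ i j k (h : ρ i j) (h' : ρ j k), i ≠ j → j ≠ k →
      α i j h * β j k h' = 0 ∧ β i j h * α j k h' = 0 := by
    intro i j k h h' hij hjk
    have e1 := hout i j j h h hij hij
    have e2 := hout j k k h' h' hjk hjk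
    -- For a return path, multiply `hinv` by the mixed product: every term then contains `α_ij β_ij`
    -- or `α_ji β_ji`, both zero. Otherwise the composite edge has a nonzero coefficient, which
    -- fixes the type of both factors.
    by_cases hik : i = k
    · subst hik
      have e3 := hinv i j h h' hij
      constructor
      · linear_combination (-(α i j h * β j i h')) * e3 + α i j h ^ 2 * e2 + β j i h' ^ 2 * e1
      · linear_combination (-(β i j h * α j i h')) * e3 + α j i h' ^ 2 * e1 + β i j h ^ 2 * e2
    · obtain ⟨e3, e4⟩ := htrans i j k h h' hij hjk hik
      rcases hne i k (_root_.trans h h') hik with e5 | e5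
      · rw [← e3] at e5
        rw [(mul_eq_zero.mp e1).resolve_left (left_ne_zero_of_mul e5),
          (mul_eq_zero.mp e2).resolve_left (right_ne_zero_of_mul e5)]
        simp
      · rw [← e4] at e5
        rw [(mul_eq_zero.mp e1).resolve_right (left_ne_zero_of_mul e5),
          (mul_eq_zero.mp e2).resolve_right (right_ne_zero_of_mul e5)]
        simp
  have hsum : ∀ i j (h : ρ i j), i ≠ j → α i j h + β i j h ≠ 0 := by
    intro i j h hij h0
    have h1 := hout i j j h h hij hij
    have h2 : α i j h * α i j h = 0 := by linear_combination α i j h * h0 - h1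
    have h3 : α i j h = 0 := mul_self_eq_zero.mp h2
    rcases hne i j h hij with h4 | h4
    · exact h4 h3
    · exact h4 (by linear_combination h0 - h3)
  let g : ∀ i j : Fin n, ρ i j → ℂˣ := fun i j h =>
    if hij : i = j then 1 else Units.mk0 _ (hsum i j h hij)
  have hgd : ∀ i h, g i i h = 1 := fun i h => by simp [g]
  have hgo : ∀ i j h, i ≠ j → (g i j h : ℂ) = α i j h + β i j h := fun i j h hij => by
    simp [g, hij]
  -- No `β`-edge touches the vertex. Isolated vertices count as direct, which is harmless because
  -- `E_ii` is symmetric.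
  let direct : Fin n → Prop := fun i =>
    (∀ j (h : ρ i j), i ≠ j → β i j h = 0) ∧ ∀ j (h : ρ j i), j ≠ i → β j i h = 0
  have hdα : ∀ i j (h : ρ i j), i ≠ j → α i j h ≠ 0 → direct i ∧ direct j := by
    intro i j h hij hα
    have z : ∀ w : ℂ, α i j h * w = 0 → w = 0 := fun w hw =>
      (mul_eq_zero.mp hw).resolve_left hα
    have z' : ∀ w : ℂ, w * α i j h = 0 → w = 0 := fun w hw =>
      (mul_eq_zero.mp hw).resolve_right hα
    exact ⟨⟨fun k hk hik => z _ (hout i j k h hk hij hik),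
        fun k hk hki => z' _ (hpath k i j hk h hki hij).2⟩,
      ⟨fun k hk hjk => z _ (hpath i j k h hk hij hjk).1,
        fun k hk hkj => z _ (hin i j k h hk hij hkj)⟩⟩
  let p : Fin n → ℂ := fun i => if direct i then 1 else 0
  have hp : ∀ i j (h : ρ i j), i ≠ j → p i = p j ∧
      ((p i = 1 ∧ β i j h = 0) ∨ (p i = 0 ∧ α i j h = 0)) := by
    intro i j h hij
    by_cases hα : α i j h = 0
    · have hβ : β i j h ≠ 0 := (hne i j h hij).resolve_left (fun h' => h' hα)
      have h1 : ¬ direct i := fun hd => hβ (hd.1 j h hij)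
      have h2 : ¬ direct j := fun hd => hβ (hd.2 i h hij)
      simp [p, h1, h2, hα]
    · obtain ⟨h1, h2⟩ := hdα i j h hij hα
      simp [p, h1, h2, h1.1 j h hij]
  have hpeq : ∀ i j, ρ i j → p i = p j := by
    intro i j h
    by_cases hij : i = j
    · rw [hij]
    · exact (hp i j h hij).1
  let P : structuralMatrixAlgebra ρ := ⟨diagonal p, fun i j hij => by
    by_cases h : i = j
    · exact h ▸ refl_of ρ i
    · exact absurd (diagonal_apply_ne p h) hij⟩
  have hcoeP : (P : Matrix (Fin n) (Fin n) ℂ) = diagonal p := rfl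
  refine ⟨g, ?_, S, P, ?_, ?_, ?_⟩
  · intro i j k hij hjk
    by_cases h1 : i = j
    · subst h1
      rw [hgd, one_mul]
    by_cases h2 : j = k
    · subst h2
      rw [hgd, mul_one]
    -- Expanding `(α + β)(α' + β')`, the mixed terms vanish by `hpath`; the rest is `htrans`, or
    -- `hinv` when the path returns.
    apply Units.ext
    rw [Units.val_mul, hgo i j hij h1, hgo j k hjk h2]
    by_cases h3 : i = k
    · subst h3
      rw [hgd, Units.val_one]
      linear_combination hinv i j hij hjk h1 + (hpath i j i hij hjk h1 h2).1 +
        (hpath i j i hij hjk h1 h2).2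
    · obtain ⟨e1, e2⟩ := htrans i j k hij hjk h1 h2 h3
      obtain ⟨e3, e4⟩ := hpath i j k hij hjk h1 h2
      rw [hgo i k _ h3]
      linear_combination e1 + e2 + e3 + e4
  · refine Subalgebra.mem_center_iff.mpr fun X => Subtype.ext ?_
    ext i j
    simp only [Subalgebra.coe_mul, hcoeP, mul_diagonal, diagonal_mul]
    by_cases h : (X : Matrix (Fin n) (Fin n) ℂ) i j = 0
    · simp [h]
    · rw [hpeq i j (rel_of_ne_zero X h), mul_comm]
  · apply Subtype.ext
    simp only [Subalgebra.coe_mul, hcoeP, diagonal_mul_diagonal]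
    congr 1
    ext i
    by_cases h : direct i <;> simp [p, h]
  · let ψ : structuralMatrixAlgebra ρ →ₗ[ℂ] Matrix (Fin n) (Fin n) ℂ :=
      { toFun := fun X => (S : Matrix (Fin n) (Fin n) ℂ) *
          ((P : Matrix (Fin n) (Fin n) ℂ) * (inducedMap g X : Matrix (Fin n) (Fin n) ℂ) +
            (1 - (P : Matrix (Fin n) (Fin n) ℂ)) *
              transpose (inducedMap g X : Matrix (Fin n) (Fin n) ℂ)) *
          (↑S⁻¹ : Matrix (Fin n) (Fin n) ℂ)
        map_add' := fun X Y => by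
          simp only [map_add, Subalgebra.coe_add, transpose_add, Matrix.mul_add, Matrix.add_mul]
          abel
        map_smul' := fun c X => by
          simp only [map_smul, Subalgebra.coe_smul, transpose_smul, Matrix.mul_smul,
            Matrix.smul_mul, ← smul_add, RingHom.id_apply] }
    suffices h : φ = ψ from fun X => LinearMap.congr_fun h X
    refine linearMap_ext_matrixUnit fun i j hij => ?_
    change _ = (S : Matrix (Fin n) (Fin n) ℂ) * _ * _
    have hsub : (1 : Matrix (Fin n) (Fin n) ℂ) - diagonal p = diagonal fun i => 1 - p i := by
      rw [← diagonal_one, ← diagonal_sub]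
    rw [inducedMap_matrixUnit, Subalgebra.coe_smul, coe_matrixUnit, hcoeP, hsub]
    by_cases h : i = j
    · subst h
      rw [hdiag, hgd]
      congr 2
      ext a b
      simp only [Matrix.add_apply, diagonal_mul, Units.val_one, one_smul, transpose_single]
      ring
    · rw [hoff i j hij h]
      congr 2
      obtain ⟨h1, h2⟩ := hp i j hij h
      rw [hgo i j hij h]
      ext a b
      simp only [Matrix.add_apply, diagonal_mul, transpose_single, smul_single,
        smul_eq_mul, mul_one, single_apply]
      by_cases hia : i = a
      · subst hia
        have h' : ¬ (j = i ∧ i = b) := fun h'' => h h''.1.symm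
        rcases h2 with ⟨h3, h4⟩ | ⟨h3, h4⟩ <;> simp [h', h3, h4]
      · by_cases hja : j = a
        · subst hja
          rw [h1] at h2
          rcases h2 with ⟨h3, h4⟩ | ⟨h3, h4⟩ <;> simp [hia, h3, h4]
        · simp [hia, hja]

/-! ### Conjugating to the normal form. -/

/-- The map `X ↦ S⁻¹ φ(X) S`. -/
noncomputable def unitsConj (S : (Matrix (Fin n) (Fin n) ℂ)ˣ)
    (φ : structuralMatrixAlgebra ρ →ₗ[ℂ] Matrix (Fin n) (Fin n) ℂ) :
    structuralMatrixAlgebra ρ →ₗ[ℂ] Matrix (Fin n) (Fin n) ℂ where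
  toFun X := (↑S⁻¹ : Matrix (Fin n) (Fin n) ℂ) * φ X * (S : Matrix (Fin n) (Fin n) ℂ)
  map_add' X Y := by rw [map_add, Matrix.mul_add, Matrix.add_mul]
  map_smul' c X := by
    rw [map_smul, Matrix.mul_smul, Matrix.smul_mul, RingHom.id_apply]

theorem unitsConj_apply (S : (Matrix (Fin n) (Fin n) ℂ)ˣ)
    (φ : structuralMatrixAlgebra ρ →ₗ[ℂ] Matrix (Fin n) (Fin n) ℂ)
    (X : structuralMatrixAlgebra ρ) :
    unitsConj S φ X =
      (↑S⁻¹ : Matrix (Fin n) (Fin n) ℂ) * φ X * (S : Matrix (Fin n) (Fin n) ℂ) := rfl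

theorem eq_conj_unitsConj (S : (Matrix (Fin n) (Fin n) ℂ)ˣ)
    (φ : structuralMatrixAlgebra ρ →ₗ[ℂ] Matrix (Fin n) (Fin n) ℂ)
    (X : structuralMatrixAlgebra ρ) :
    φ X = (S : Matrix (Fin n) (Fin n) ℂ) * unitsConj S φ X *
      (↑S⁻¹ : Matrix (Fin n) (Fin n) ℂ) := by
  rw [unitsConj_apply, ← Matrix.mul_assoc, ← Matrix.mul_assoc, Units.mul_inv, Matrix.one_mul,
    Matrix.mul_assoc, Units.mul_inv, Matrix.mul_one]

theorem PreservesRankOne.conj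
    {φ : structuralMatrixAlgebra ρ →ₗ[ℂ] Matrix (Fin n) (Fin n) ℂ} (hφ : PreservesRankOne φ)
    (S : (Matrix (Fin n) (Fin n) ℂ)ˣ) : PreservesRankOne (unitsConj S φ) := by
  intro X hX
  rw [← rank_units_conj S, ← eq_conj_unitsConj]
  exact hφ X hX

theorem IsJordanHom.conj
    {φ : structuralMatrixAlgebra ρ →ₗ[ℂ] Matrix (Fin n) (Fin n) ℂ} (hφ : IsJordanHom φ)
    (S : (Matrix (Fin n) (Fin n) ℂ)ˣ) : IsJordanHom (unitsConj S φ) := by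
  have key : ∀ A B : Matrix (Fin n) (Fin n) ℂ,
      (↑S⁻¹ : Matrix (Fin n) (Fin n) ℂ) * A * (S : Matrix (Fin n) (Fin n) ℂ) *
        ((↑S⁻¹ : Matrix (Fin n) (Fin n) ℂ) * B * (S : Matrix (Fin n) (Fin n) ℂ)) =
      (↑S⁻¹ : Matrix (Fin n) (Fin n) ℂ) * (A * B) * (S : Matrix (Fin n) (Fin n) ℂ) := by
    intro A B
    simp only [Matrix.mul_assoc, Units.mul_inv_cancel_left]
  intro X Y
  simp only [unitsConj_apply, key, hφ X Y, Matrix.mul_add, Matrix.add_mul]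

theorem eq_single_add_single {i j : Fin n} (hij : i ≠ j) (M : Matrix (Fin n) (Fin n) ℂ)
    (h : ∀ a b, ¬ (a = i ∧ b = j) → ¬ (a = j ∧ b = i) → M a b = 0) :
    M = single i j (M i j) + single j i (M j i) := by
  ext a b
  rw [Matrix.add_apply]
  by_cases h1 : a = i ∧ b = j
  · obtain ⟨rfl, rfl⟩ := h1
    simp [hij, hij.symm]
  by_cases h2 : a = j ∧ b = i
  · obtain ⟨rfl, rfl⟩ := h2
    simp [hij, hij.symm]
  rw [h a b h1 h2, single_apply_of_ne _ _ _ _ _ (fun h' => h1 ⟨h'.1.symm, h'.2.symm⟩),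
    single_apply_of_ne _ _ _ _ _ (fun h' => h2 ⟨h'.1.symm, h'.2.symm⟩), add_zero]

theorem exists_associated_of_unitsConj
    {φ : structuralMatrixAlgebra ρ →ₗ[ℂ] Matrix (Fin n) (Fin n) ℂ}
    (S : (Matrix (Fin n) (Fin n) ℂ)ˣ) (ψ : structuralMatrixAlgebra ρ →ₗ[ℂ] Matrix (Fin n) (Fin n) ℂ)
    (hψ : ψ = unitsConj S φ)
    (hdiag : ∀ i, ψ (matrixUnit i i (refl_of ρ i)) = single i i 1)
    (hoff : ∀ i j (h : ρ i j), i ≠ j → ψ (matrixUnit i j h) =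
      single i j (ψ (matrixUnit i j h) i j) + single j i (ψ (matrixUnit i j h) j i))
    (hne : ∀ i j (h : ρ i j), ψ (matrixUnit i j h) ≠ 0)
    (hout : ∀ i j k (h : ρ i j) (h' : ρ i k), i ≠ j → i ≠ k →
      ψ (matrixUnit i j h) i j * ψ (matrixUnit i k h') k i = 0)
    (hin : ∀ i j k (h : ρ i j) (h' : ρ k j), i ≠ j → k ≠ j →
      ψ (matrixUnit i j h) i j * ψ (matrixUnit k j h') j k = 0)
    (htrans : ∀ i j k (h : ρ i j) (h' : ρ j k), i ≠ j → j ≠ k → i ≠ k →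
      ψ (matrixUnit i j h) i j * ψ (matrixUnit j k h') j k =
          ψ (matrixUnit i k (_root_.trans h h')) i k ∧
        ψ (matrixUnit i j h) j i * ψ (matrixUnit j k h') k j =
          ψ (matrixUnit i k (_root_.trans h h')) k i)
    (hinv : ∀ i j (h : ρ i j) (h' : ρ j i), i ≠ j →
      ψ (matrixUnit i j h) i j * ψ (matrixUnit j i h') j i +
        ψ (matrixUnit i j h) j i * ψ (matrixUnit j i h') i j = 1) :
    ∃ g : ∀ i j : Fin n, ρ i j → ℂˣ, IsAssociatedTransitiveMap φ g := by
  refine exists_associated_of_normalForm S (fun i j h => ψ (matrixUnit i j h) i j)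
    (fun i j h => ψ (matrixUnit i j h) j i) (fun i => ?_) (fun i j h hij => ?_)
    (fun i j h hij => ?_) hout hin htrans hinv
  · rw [← hdiag, hψ]
    exact eq_conj_unitsConj S φ _
  · rw [← hoff i j h hij, hψ]
    exact eq_conj_unitsConj S φ _
  · by_contra! h0
    apply hne i j h
    rw [hoff i j h hij, h0.1, h0.2]
    simp

/-! ### Rank-one preservers. -/

theorem PreservesRankOne.apply_matrixUnit_eq
    {ψ : structuralMatrixAlgebra ρ →ₗ[ℂ] Matrix (Fin n) (Fin n) ℂ} (hψ : PreservesRankOne ψ)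
    (hdiag : ∀ i, ψ (matrixUnit i i (refl_of ρ i)) = single i i 1) {i j : Fin n} (h : ρ i j)
    (hij : i ≠ j) :
    ψ (matrixUnit i j h) =
      single i j (ψ (matrixUnit i j h) i j) + single j i (ψ (matrixUnit i j h) j i) := by
  refine eq_single_add_single hij _ fun a b h1 h2 => ?_
  -- The minor of the image of `E_ii ± E_ij` with pivot `(i, i)` isolates the `(a, b)` entry once
  -- the two signs are compared. In the remaining case `a` and `b` both avoid `j`, and `E_ij ± E_jj`
  -- with pivot `(j, j)` does the same.
  by_cases hab : a ≠ i ∧ b ≠ i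
  · obtain ⟨ha, hb⟩ := hab
    have e1 := hψ.rectangle_minors (refl_of ρ i) h (refl_of ρ i) h 1 0 1 1 _ rfl i i a b
    have e2 := hψ.rectangle_minors (refl_of ρ i) h (refl_of ρ i) h 1 0 1 (-1) _ rfl i i a b
    simp [hdiag, ha.symm, hb.symm] at e1 e2
    linear_combination (e1 - e2) / 2
  · have ha : a ≠ j := by
      rintro rfl
      exact hab ⟨hij.symm, fun hb => h2 ⟨rfl, hb⟩⟩
    have hb : b ≠ j := by
      rintro rfl
      exact hab ⟨fun ha => h1 ⟨ha, rfl⟩, hij.symm⟩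
    have e1 := hψ.rectangle_minors h h (refl_of ρ j) (refl_of ρ j) 1 1 1 0 _ rfl j j a b
    have e2 := hψ.rectangle_minors h h (refl_of ρ j) (refl_of ρ j) 1 (-1) 1 0 _ rfl j j a b
    simp [hdiag, ha.symm, hb.symm] at e1 e2
    linear_combination (e1 + e2) / 2 - e2

theorem rank_matrixUnit (i j : Fin n) (h : ρ i j) :
    (matrixUnit i j h : Matrix (Fin n) (Fin n) ℂ).rank = 1 := by
  rw [coe_matrixUnit, single_eq_single_vecMulVec_single, rank_eq_one_iff_minors]
  refine ⟨fun h0 => ?_, fun a b c d => ?_⟩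
  · have := congrFun (congrFun h0 i) j
    simp [vecMulVec_apply] at this
  · simp only [vecMulVec_apply]
    ring

theorem one_eq_sum_matrixUnit :
    (1 : structuralMatrixAlgebra ρ) = ∑ i, matrixUnit i i (refl_of ρ i) := by
  apply Subtype.ext
  push_cast
  simp only [coe_matrixUnit]
  ext a b
  simp [Matrix.sum_apply, single_apply, one_apply, ite_and]

theorem PreservesRankOne.exists_associated
    {φ : structuralMatrixAlgebra ρ →ₗ[ℂ] Matrix (Fin n) (Fin n) ℂ} (hφ : PreservesRankOne φ)
    (h1 : φ 1 = 1) : ∃ g : ∀ i j : Fin n, ρ i j → ℂˣ, IsAssociatedTransitiveMap φ g := by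
  obtain ⟨S, hS⟩ := exists_units_conj_eq_single_of_rank_one
    (fun i => φ (matrixUnit i i (refl_of ρ i))) (fun i => hφ _ (rank_matrixUnit _ _ _))
    (by rw [← map_sum, ← one_eq_sum_matrixUnit, h1])
  have hψ := hφ.conj S
  have hdiag : ∀ i, unitsConj S φ (matrixUnit i i (refl_of ρ i)) = single i i 1 := hS
  obtain ⟨ψ, hψdef⟩ : ∃ ψ, ψ = unitsConj S φ := ⟨_, rfl⟩
  rw [← hψdef] at hψ hdiag
  have hoff := fun i j (h : ρ i j) (hij : i ≠ j) => hψ.apply_matrixUnit_eq hdiag h hij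
  have hself : ∀ i j (h : ρ i j), i ≠ j →
      ψ (matrixUnit i j h) i j * ψ (matrixUnit i j h) j i = 0 := by
    intro i j h hij
    rw [hψ.minors _ _ _ (single_eq_single_vecMulVec_single i j) i j j i, hoff i j h hij]
    simp [hij, hij.symm]
  refine exists_associated_of_unitsConj S ψ hψdef hdiag hoff ?_ ?_ ?_ ?_ ?_
  · intro i j h
    exact ((rank_eq_one_iff_minors _).mp (hψ _ (rank_matrixUnit i j h))).1
  · intro i j k h h' hij hik
    by_cases hjk : j = k
    · subst hjk
      exact hself i j h hij
    have e := hψ.rectangle_minors h h' h h' 1 0 1 1 _ rfl i j k i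
    rw [hoff i j h hij, hoff i k h' hik] at e
    simpa [single_apply, hij, hik, hjk, hij.symm, hik.symm, Ne.symm hjk] using e
  · intro i j k h h' hij hkj
    by_cases hik : i = k
    · subst hik
      exact hself i j h hij
    have e := hψ.rectangle_minors h h h' h' 1 1 1 0 _ rfl i j j k
    rw [hoff i j h hij, hoff k j h' hkj] at e
    simpa [single_apply, hij, hik, hkj, hij.symm, hkj.symm, Ne.symm hik] using e
  · intro i j k h h' hij hjk hik
    -- The rectangle with rows `i, j` and columns `j, k` contains `E_jj`, whose image supplies the
    -- entry `1` multiplying the coefficient of `E_ik`.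
    have e1 := hψ.rectangle_minors h (_root_.trans h h') (refl_of ρ j) h' 1 1 1 1 _ rfl i j j k
    have e2 := hψ.rectangle_minors h (_root_.trans h h') (refl_of ρ j) h' 1 1 1 1 _ rfl j i k j
    rw [hoff i j h hij, hoff j k h' hjk, hoff i k _ hik, hdiag] at e1 e2
    constructor
    · simpa [single_apply, hij, hik, hjk, hij.symm, hik.symm, hjk.symm] using e1
    · simpa [single_apply, hij, hik, hjk, hij.symm, hik.symm, hjk.symm] using e2
  · intro i j h h' hij
    -- On the full square on `{i, j}` the off-diagonal entries are `α_ij + β_ji` and `β_ij + α_ji`,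
    -- with product `1`; `hself` removes the unwanted terms.
    have e := hψ.rectangle_minors (refl_of ρ i) h h' (refl_of ρ j) 1 1 1 1 _ rfl i j j i
    rw [hoff i j h hij, hoff j i h' hij.symm, hdiag, hdiag] at e
    simp [hij, hij.symm] at e
    linear_combination e - hself i j h hij - hself j i h' hij.symm

/-! ### Jordan homomorphisms. -/

theorem IsJordanHom.exists_associated
    {φ : structuralMatrixAlgebra ρ →ₗ[ℂ] Matrix (Fin n) (Fin n) ℂ} (hφ : IsJordanHom φ)
    (hne : ∀ (i j : Fin n) (h : ρ i j), φ (matrixUnit i j h) ≠ 0) :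
    ∃ g : ∀ i j : Fin n, ρ i j → ℂˣ, IsAssociatedTransitiveMap φ g := by
  have hidem : ∀ i, φ (matrixUnit i i (refl_of ρ i)) * φ (matrixUnit i i (refl_of ρ i)) =
      φ (matrixUnit i i (refl_of ρ i)) := by
    intro i
    have h := hφ (matrixUnit i i (refl_of ρ i)) (matrixUnit i i (refl_of ρ i))
    have hE : matrixUnit i i (refl_of ρ i) * matrixUnit i i (refl_of ρ i) =
        matrixUnit i i (refl_of ρ i) := by
      apply Subtype.ext
      simp [coe_matrixUnit]
    rw [hE, map_add, ← two_smul ℂ, ← two_smul ℂ] at h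
    exact (smul_right_injective _ (two_ne_zero' ℂ) h).symm
  have horth : ∀ i j, i ≠ j →
      φ (matrixUnit i i (refl_of ρ i)) * φ (matrixUnit j j (refl_of ρ j)) = 0 := by
    intro i j hij
    have h := hφ (matrixUnit i i (refl_of ρ i)) (matrixUnit j j (refl_of ρ j))
    have hE : matrixUnit i i (refl_of ρ i) * matrixUnit j j (refl_of ρ j) +
        matrixUnit j j (refl_of ρ j) * matrixUnit i i (refl_of ρ i) = 0 := by
      apply Subtype.ext
      simp [coe_matrixUnit, hij, hij.symm]
    rw [hE, map_zero] at h
    have hi := hidem i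
    generalize φ (matrixUnit i i (refl_of ρ i)) = e at *
    generalize φ (matrixUnit j j (refl_of ρ j)) = f at *
    -- Multiplying `e f + f e = 0` by `e` on either side gives `e f = -e f e = f e`, hence `2 e f =
    -- 0`.
    have h1 : e * f + e * f * e = 0 := by
      have := congrArg (e * ·) h.symm
      simpa [Matrix.mul_add, ← Matrix.mul_assoc, hi] using this
    have h2 : e * f * e + f * e = 0 := by
      have := congrArg (· * e) h.symm
      simpa [Matrix.add_mul, Matrix.mul_assoc, hi] using this
    have h3 : (2 : ℂ) • (e * f) = 0 := by
      have h4 : (2 : ℂ) • (e * f) = (e * f + e * f * e) - (e * f * e + f * e) + (e * f + f * e) := by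
        module
      rw [h4, h1, h2, ← h]
      simp
    exact (smul_eq_zero.mp h3).resolve_left two_ne_zero
  obtain ⟨S, hS⟩ := exists_units_conj_eq_single_of_orthogonal
    (fun i => φ (matrixUnit i i (refl_of ρ i))) (fun i => hne _ _ _) hidem horth
  have hψ := hφ.conj S
  have hdiag : ∀ i, unitsConj S φ (matrixUnit i i (refl_of ρ i)) = single i i 1 := hS
  have hne' : ∀ (i j : Fin n) (h : ρ i j), unitsConj S φ (matrixUnit i j h) ≠ 0 := by
    intro i j h h0
    refine hne i j h ?_
    rw [eq_conj_unitsConj S φ, h0]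
    simp
  obtain ⟨ψ, hψdef⟩ : ∃ ψ, ψ = unitsConj S φ := ⟨_, rfl⟩
  rw [← hψdef] at hψ hdiag hne'
  -- Peirce decomposition: the image `M` satisfies `M = E_ii M + M E_ii`, so at a nonzero entry
  -- exactly one index equals `i`; likewise exactly one equals `j`.
  have hoff : ∀ i j (h : ρ i j), i ≠ j → ψ (matrixUnit i j h) =
      single i j (ψ (matrixUnit i j h) i j) + single j i (ψ (matrixUnit i j h) j i) := by
    intro i j h hij
    have e1 := hψ (matrixUnit i i (refl_of ρ i)) (matrixUnit i j h)
    have e2 := hψ (matrixUnit i j h) (matrixUnit j j (refl_of ρ j))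
    have hE1 : matrixUnit i i (refl_of ρ i) * matrixUnit i j h +
        matrixUnit i j h * matrixUnit i i (refl_of ρ i) = matrixUnit i j h := by
      apply Subtype.ext
      simp [coe_matrixUnit, hij.symm]
    have hE2 : matrixUnit i j h * matrixUnit j j (refl_of ρ j) +
        matrixUnit j j (refl_of ρ j) * matrixUnit i j h = matrixUnit i j h := by
      apply Subtype.ext
      simp [coe_matrixUnit, hij.symm]
    rw [hE1, hdiag] at e1
    rw [hE2, hdiag] at e2
    refine eq_single_add_single hij _ fun a b h1 h2 => ?_
    generalize ψ (matrixUnit i j h) = M at *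
    have e1 := congrFun (congrFun e1 a) b
    have e2 := congrFun (congrFun e2 a) b
    have hs : ∀ i : Fin n, single i i (1 : ℂ) = diagonal (Pi.single i 1) :=
      fun i => (diagonal_single i 1).symm
    rw [hs, Matrix.add_apply, mul_diagonal, diagonal_mul] at e1 e2
    simp only [Pi.single_apply] at e1 e2
    by_cases ha : a = i
    · by_cases hb : b = i
      · simp only [ha, hb, if_true] at e1 ⊢
        linear_combination -e1
      · by_cases hbj : b = j
        · exact absurd ⟨ha, hbj⟩ h1
        · simpa [ha, hij, hbj] using e2
    · by_cases hb : b = i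
      · by_cases haj : a = j
        · exact absurd ⟨haj, hb⟩ h2
        · simpa [hb, hij, haj] using e2
      · simpa [ha, hb] using e1
  refine exists_associated_of_unitsConj S ψ hψdef hdiag hoff hne' ?_ ?_ ?_ ?_
  · intro i j k h h' hij hik
    have e := hψ (matrixUnit i j h) (matrixUnit i k h')
    have hE : matrixUnit i j h * matrixUnit i k h' + matrixUnit i k h' * matrixUnit i j h = 0 := by
      apply Subtype.ext
      simp [coe_matrixUnit, hij.symm, hik.symm]
    rw [hE, map_zero, hoff i j h hij, hoff i k h' hik] at e
    by_cases hjk : j = k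
    · subst hjk
      have := congrFun (congrFun e i) i
      simp [Matrix.add_mul, Matrix.mul_add, hij, hij.symm] at this
      linear_combination (-1 / 2 : ℂ) * this
    · have := congrFun (congrFun e k) j
      simpa [Matrix.add_mul, Matrix.mul_add, single_apply, hij, hik, hij.symm, hik.symm, hjk,
        Ne.symm hjk, mul_comm] using this
  · intro i j k h h' hij hkj
    have e := hψ (matrixUnit i j h) (matrixUnit k j h')
    have hE : matrixUnit i j h * matrixUnit k j h' + matrixUnit k j h' * matrixUnit i j h = 0 := by
      apply Subtype.ext
      simp [coe_matrixUnit, hij.symm, hkj.symm]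
    rw [hE, map_zero, hoff i j h hij, hoff k j h' hkj] at e
    by_cases hik : i = k
    · subst hik
      have := congrFun (congrFun e i) i
      simp [Matrix.add_mul, Matrix.mul_add, hij, hij.symm] at this
      linear_combination (-1 / 2 : ℂ) * this
    · have := congrFun (congrFun e i) k
      simpa [Matrix.add_mul, Matrix.mul_add, single_apply, hij, hkj, hij.symm, hkj.symm, hik,
        Ne.symm hik] using this
  · intro i j k h h' hij hjk hik
    have e := hψ (matrixUnit i j h) (matrixUnit j k h')
    have hE : matrixUnit i j h * matrixUnit j k h' + matrixUnit j k h' * matrixUnit i j h =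
        matrixUnit i k (_root_.trans h h') := by
      apply Subtype.ext
      simp [coe_matrixUnit, hik.symm]
    rw [hE] at e
    -- The `α`-parts multiply in the given order and land at `(i, k)`; the `β`-parts multiply in
    -- reverse and land at `(k, i)`.
    have e1 := congrFun (congrFun e i) k
    have e2 := congrFun (congrFun e k) i
    rw [hoff i j h hij, hoff j k h' hjk] at e1 e2
    constructor
    · simpa [Matrix.add_mul, Matrix.mul_add, single_apply, hij, hjk, hij.symm, hjk.symm, hik,
        hik.symm] using e1.symm
    · simpa [Matrix.add_mul, Matrix.mul_add, single_apply, hij, hjk, hij.symm, hjk.symm, hik,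
        hik.symm, mul_comm] using e2.symm
  · intro i j h h' hij
    have e := hψ (matrixUnit i j h) (matrixUnit j i h')
    have hE : matrixUnit i j h * matrixUnit j i h' + matrixUnit j i h' * matrixUnit i j h =
        matrixUnit i i (refl_of ρ i) + matrixUnit j j (refl_of ρ j) := by
      apply Subtype.ext
      simp [coe_matrixUnit]
    rw [hE, map_add, hdiag, hdiag, hoff i j h hij, hoff j i h' hij.symm] at e
    have := congrFun (congrFun e i) i
    simp [Matrix.add_mul, Matrix.mul_add, hij, hij.symm] at this
    linear_combination -this

end StructuralMatrixAlgebra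

theorem mainTheorem3 (n : ℕ) (ρ : Fin n → Fin n → Prop) [IsPreorder (Fin n) ρ] :
    (∀ φ : structuralMatrixAlgebra ρ →ₗ[ℂ] Matrix (Fin n) (Fin n) ℂ,
      φ 1 = 1 → StructuralMatrixAlgebra.PreservesRankOne φ →
        StructuralMatrixAlgebra.IsJordanEmbedding φ) ∧
    (∀ φ : structuralMatrixAlgebra ρ →ₗ[ℂ] Matrix (Fin n) (Fin n) ℂ,
      StructuralMatrixAlgebra.IsJordanHom φ →
      (∀ (i j : Fin n) (h : ρ i j), φ (StructuralMatrixAlgebra.matrixUnit i j h) ≠ 0) →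
        (∃ g : ∀ i j : Fin n, ρ i j → ℂˣ,
          StructuralMatrixAlgebra.IsAssociatedTransitiveMap φ g) ∧
        ∀ g : ∀ i j : Fin n, ρ i j → ℂˣ,
          StructuralMatrixAlgebra.IsAssociatedTransitiveMap φ g →
            (StructuralMatrixAlgebra.PreservesRankOne φ ↔
              StructuralMatrixAlgebra.RectangleMinorsVanish g)) := by
  refine ⟨fun φ h1 hφ => ?_, fun φ hφ hne => ⟨hφ.exists_associated hne, fun g hg => ?_⟩⟩
  · obtain ⟨g, hg⟩ := StructuralMatrixAlgebra.PreservesRankOne.exists_associated hφ h1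
    exact StructuralMatrixAlgebra.isJordanEmbedding_of_associated hg
  · exact StructuralMatrixAlgebra.preservesRankOne_iff hg
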